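/- Let $n\ge 1$. An ascent sequence of length $n$ is a sequence $\mathbf a=(a_1,\dots,a_n)$ of non-negative integers with $a_1=0$ and $a_i\le \mathrm{asc}(a_1,\dots,a_{i-1})+1$ for $1<i\le n$, where $\mathrm{asc}(b_1,\dots,b_k)$ is the number of $j\in\{1,\dots,k-1\}$ with $b_j<b_{j+1}$. Let $\mathsf{CAsc}_n$ be the set of ascent sequences of length $n$ that avoid the pattern $101$, i.e. for which there are no $i<j<k$ with $a_i=a_k>a_j$. For a finite poset $P$ and $x\in P$ let $D(x)=\{y\in P: y<x\}$. If $P$ is $(2+2)$-free (has no induced subposet isomorphic to a disjoint union of two 2-element chains), the distinct sets $D(x)$ form a chain $\emptyset=D_0\subsetneq D_1\subsetneq\dots\subsetneq D_{\ell(P)}$; an element $x$ with $D(x)=D_i$ is said to lie at level $i$. Let $\ell^\star(P)$ be the least level that contains a maximal element of $P$. To an ascent sequence $\mathbf a=(a_1,\dots,a_n)$ associate a poset $f_{AP}(\mathbf a)=P^{(n)}$, considered up to isomorphism, as follows. $P^{(1)}$ is the one-element poset. For $1\le k<n$, the poset $P^{(k+1)}$ is obtained from $P=P^{(k)}$ by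 adding one new element $p$: 1. if $0\le a_{k+1}\le \ell^\star(P)$, then $p$ is a new maximal element whose strict downset is $D_{a_{k+1}}$; 2. if $a_{k+1}=\ell(P)+1$, then $p$ is placed above all elements of $P$; 3. if $\ell^\star(P)<a_{k+1}\le \ell(P)$, then $p$ is a new maximal element with strict downset $D_{a_{k+1}}$, and in addition one adds all relations $x<y$ where $x$ is a maximal element of $P$ at a level less than $a_{k+1}$ and $y$ is an element of $P$ at a level at least $a_{k+1}$ (levels taken in $P$). Let $\mathsf{CPosets}_n$ be the set of isomorphism classes of $n$-element posets that are $(2+2)$-free and $N$-free, i.e. that also have no induced subposet on four elements $e,f,g,h$ whose strict relations are exactly $e<h$, $f<h$, $f<g$ (the series-parallel $(2+2)$-free posets). Then $f_{AP}$ restricts to a bijection $\mathsf{CAsc}_n\to\mathsf{CPosets}_n$: it maps $\mathsf{CAsc}_n$ into $\mathsf{CPosets}_n$, is injective on $\mathsf{CAsc}_n$, and every element of $\mathsf{CPosets}_n$ is the image of an element of $\mathsf{CAsc}_n$. -/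

import Mathlib

namespace AscPoset

/-! ### Sequences of non-negative integers -/

/-- The number of ascents of a finite sequence: positions `j` with `b_j < b_{j+1}`. -/
noncomputable def asc {k : ℕ} (b : Fin k → ℕ) : ℕ :=
  {j : ℕ | ∃ h : j + 1 < k, b ⟨j, Nat.lt_of_succ_lt h⟩ < b ⟨j + 1, h⟩}.ncard

/-- The truncated sequence consisting of the entries strictly before position `i`. -/
def before {n : ℕ} (a : Fin n → ℕ) (i : Fin n) : Fin i.1 → ℕ :=
  fun j => a (Fin.castLE i.2.le j)

/-- Ascent sequences: the first entry is `0`, and every later entry is at most one more than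
the number of ascents of the sequence of all the entries before it. -/
def IsAscentSeq {n : ℕ} (a : Fin n → ℕ) : Prop :=
  (∀ i : Fin n, i.1 = 0 → a i = 0) ∧
  (∀ i : Fin n, 0 < i.1 → a i ≤ asc (before a i) + 1)

/-- `a` contains `b` as a pattern: some subsequence of `a` is in the same relative order as `b`
(the equivalence for both `(s, t)` and `(t, s)` covers equal entries too). -/
def ContainsPattern {r s : ℕ} (a : Fin r → ℕ) (b : Fin s → ℕ) : Prop :=
  ∃ f : Fin s → Fin r, StrictMono f ∧ ∀ i j : Fin s, a (f i) < a (f j) ↔ b i < b j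

/-- The set of `101`-avoiding ascent sequences of length `n`. -/
def CAsc (n : ℕ) : Set (Fin n → ℕ) :=
  {a | IsAscentSeq a ∧ ¬ ContainsPattern a ![1, 0, 1]}

/-! ### Posets -/

/-- Two posets are isomorphic. -/
def Isom {α β : Type} (P : PartialOrder α) (Q : PartialOrder β) : Prop :=
  Nonempty (α ≃o β)

/-- Isomorphism of partial orders on the label set `Fin n`. -/
def isomSetoid (n : ℕ) : Setoid (PartialOrder (Fin n)) where
  r P Q := Isom P Q
  iseqv :=
    { refl := fun P => ⟨@OrderIso.refl (Fin n) P.toLE⟩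
      symm := fun {P Q} ⟨e⟩ => ⟨@OrderIso.symm _ _ P.toLE Q.toLE e⟩
      trans := fun {P Q R} ⟨e⟩ ⟨f⟩ => ⟨@OrderIso.trans _ _ _ P.toLE Q.toLE R.toLE e f⟩ }

/-- Unlabelled posets on `n` elements: isomorphism classes of partial orders on `Fin n`. -/
def UPoset (n : ℕ) : Type := Quotient (isomSetoid n)

/-- The isomorphism class of a labelled poset. -/
def unlabel {n : ℕ} (P : PartialOrder (Fin n)) : UPoset n := Quotient.mk (isomSetoid n) P

/-- `x` and `y` are incomparable (in particular distinct). -/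
def Incomp {α : Type} (P : PartialOrder α) (x y : α) : Prop := ¬ x ≤ y ∧ ¬ y ≤ x

/-- No induced subposet is a disjoint union of two 2-element chains `e < f` and `g < h`. -/
def TwoPlusTwoFree {α : Type} (P : PartialOrder α) : Prop :=
  ¬ ∃ e f g h : α, e < f ∧ g < h ∧
    Incomp P e g ∧ Incomp P e h ∧ Incomp P f g ∧ Incomp P f h

/-- No induced subposet is the four-element poset N, whose strict relations are exactly
`e < h`, `f < h`, `f < g`. -/
def NFree {α : Type} (P : PartialOrder α) : Prop :=
  ¬ ∃ e f g h : α, e < h ∧ f < h ∧ f < g ∧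
    Incomp P e f ∧ Incomp P e g ∧ Incomp P g h

/-- Unlabelled posets on `n` elements that are both (2+2)-free and N-free. -/
def CPosets (n : ℕ) : Set (UPoset n) :=
  {X | ∃ P : PartialOrder (Fin n), TwoPlusTwoFree P ∧ NFree P ∧ unlabel P = X}

/-! ### Levels -/

/-- `ell P` is the number of distinct nonempty strict downsets `D(x) = Set.Iio x`. -/
noncomputable def ell {α : Type} (P : PartialOrder α) : ℕ :=
  {D : Set α | D ∈ Set.range (fun y : α => Set.Iio y) ∧ D.Nonempty}.ncard

/-- The level of `x`: the number of distinct strict downsets properly contained in `D(x)`. When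
the strict downsets form a chain `∅ = D_0 ⊂ D_1 ⊂ ⋯ ⊂ D_ℓ`, which is the case exactly for
(2+2)-free posets, this is the index `i` with `D(x) = D_i`. -/
noncomputable def level {α : Type} (P : PartialOrder α) (x : α) : ℕ :=
  {D : Set α | D ∈ Set.range (fun y : α => Set.Iio y) ∧ D ⊂ Set.Iio x}.ncard

/-- The minimum index of a level that contains a maximal element. -/
noncomputable def ellStar {α : Type} (P : PartialOrder α) : ℕ :=
  sInf {i : ℕ | ∃ x : α, IsMax x ∧ level P x = i}

theorem level_lt {α : Type} [Finite α] (P : PartialOrder α) {x y : α} (h : x < y) :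
    level P x < level P y := by
  have hss : Set.Iio x ⊂ Set.Iio y :=
    ⟨fun z hz => lt_trans hz h, fun hc => lt_irrefl x (hc h)⟩
  refine Set.ncard_lt_ncard ⟨?_, ?_⟩ (Set.toFinite _)
  · rintro D ⟨hD, hDx⟩
    exact ⟨hD, hDx.trans hss⟩
  · intro hc
    exact (hc ⟨⟨x, rfl⟩, hss⟩).2.ne rfl

/-! ### Adding elements and relations -/

/-- The poset obtained from `P` by adding a new maximal element `none`, whose strict downset is
the downward closed set `S`. -/
@[reducible] def addMax {α : Type} (P : PartialOrder α) (S : Set α) (hS : IsLowerSet S) :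
    PartialOrder (Option α) where
  le u v :=
    match u, v with
    | some x, some y => x ≤ y
    | some x, none => x ∈ S
    | none, some _ => False
    | none, none => True
  lt u v :=
    match u, v with
    | some x, some y => x < y
    | some x, none => x ∈ S
    | none, _ => False
  lt_iff_le_not_ge u v := by
    cases u <;> cases v
    · exact ⟨False.elim, fun h => h.2 trivial⟩
    · exact ⟨False.elim, fun h => h.1⟩
    · exact ⟨fun h => ⟨h, fun h' => h'⟩, fun h => h.1⟩
    · exact lt_iff_le_not_ge
  le_refl u := by
    cases u
    · trivial
    · exact le_refl _
  le_trans u v w := by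
    cases u <;> cases v <;> cases w <;> intro h₁ h₂
    all_goals first
      | trivial
      | exact h₁.elim
      | exact h₂.elim
      | exact le_trans h₁ h₂
      | exact hS h₁ h₂
  le_antisymm u v := by
    cases u <;> cases v <;> intro h₁ h₂
    all_goals first
      | rfl
      | exact h₁.elim
      | exact h₂.elim
      | exact congrArg some (le_antisymm h₁ h₂)

/-- The set `D_a` of the elements below the elements of level `a`. -/
def belowLevel {α : Type} (P : PartialOrder α) (a : ℕ) : Set α :=
  {y | ∃ z : α, level P z = a ∧ y < z}

theorem belowLevel_isLowerSet {α : Type} (P : PartialOrder α) (a : ℕ) :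
    IsLowerSet (belowLevel P a) := by
  rintro x y hyx ⟨z, hz, hxz⟩
  exact ⟨z, hz, lt_of_le_of_lt hyx hxz⟩

/-- The strict relations of `P`, together with `x < y` for all maximal elements `x` of `P` that
lie at a level less than `a` and all elements `y` that lie at level `a` or higher. -/
def liftRel {α : Type} (P : PartialOrder α) (a : ℕ) (x y : α) : Prop :=
  x < y ∨ ((IsMax x ∧ level P x < a) ∧ a ≤ level P y)

theorem liftRel_level_lt {α : Type} [Finite α] (P : PartialOrder α) {a : ℕ} {x y : α}
    (h : liftRel P a x y) : level P x < level P y := by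
  rcases h with h | ⟨⟨_, h₁⟩, h₂⟩
  · exact level_lt P h
  · exact lt_of_lt_of_le h₁ h₂

theorem liftRel_trans_level_lt {α : Type} [Finite α] (P : PartialOrder α) {a : ℕ} {x y : α}
    (h : Relation.TransGen (liftRel P a) x y) : level P x < level P y := by
  induction h with
  | single h => exact liftRel_level_lt P h
  | tail _ h ih => exact ih.trans (liftRel_level_lt P h)

/-- The poset on the same elements as `P` generated by the relations `liftRel P a`. -/
@[reducible] def liftPoset {α : Type} [Finite α] (P : PartialOrder α) (a : ℕ) : PartialOrder α where
  le x y := x = y ∨ Relation.TransGen (liftRel P a) x y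
  lt x y := Relation.TransGen (liftRel P a) x y
  lt_iff_le_not_ge x y := by
    constructor
    · intro h
      refine ⟨Or.inr h, ?_⟩
      rintro (rfl | h')
      · exact lt_irrefl _ (liftRel_trans_level_lt P h)
      · exact lt_irrefl _ (liftRel_trans_level_lt P (h.trans h'))
    · rintro ⟨rfl | h, h'⟩
      · exact absurd (Or.inl rfl) h'
      · exact h
  le_refl x := Or.inl rfl
  le_trans x y z := by
    rintro (rfl | h₁) (rfl | h₂)
    · exact Or.inl rfl
    · exact Or.inr h₂
    · exact Or.inr h₁
    · exact Or.inr (h₁.trans h₂)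
  le_antisymm x y := by
    rintro (rfl | h₁) (h₂ | h₂)
    · rfl
    · rfl
    · exact h₂.symm
    · exact absurd (liftRel_trans_level_lt P (h₁.trans h₂)) (lt_irrefl _)

theorem belowLevel_isLowerSet_lift {α : Type} [Finite α] (P : PartialOrder α) (a : ℕ) :
    @IsLowerSet α (liftPoset P a).toLE (belowLevel P a) := by
  rintro x y hyx ⟨z, hz, hxz⟩
  rcases hyx with rfl | h
  · exact ⟨z, hz, hxz⟩
  · refine ⟨z, hz, ?_⟩
    induction h using Relation.TransGen.head_induction_on with
    | single h =>
      rcases h with h | ⟨_, h⟩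
      · exact h.trans hxz
      · have := level_lt P hxz
        omega
    | head h _ ih =>
      rcases h with h | ⟨_, h⟩
      · exact h.trans ih
      · have := level_lt P ih
        omega

/-! ### From ascent sequences to posets -/

open Classical in
/-- One step of the construction: the element `none` is added to `P` according to the value `a`.

* If `a ≤ ℓ*(P)`, add a new maximal element with the same strict downset as the elements of
  level `a`.
* If `a = ℓ(P) + 1`, add a new element above all the elements of `P`.
* If `ℓ*(P) < a ≤ ℓ(P)`, add a new element with the same strict downset in `P` as the elements
  of level `a`, and put every maximal element of `P` of level less than `a` below every element
  of `P` of level at least `a`.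

(No other value of `a` arises from an ascent sequence.) -/
@[reducible] noncomputable def apStep {α : Type} [Finite α] (P : PartialOrder α) (a : ℕ) :
    PartialOrder (Option α) :=
  if a ≤ ellStar P then
    addMax P (belowLevel P a) (belowLevel_isLowerSet P a)
  else if a = ell P + 1 then
    addMax P Set.univ (fun _ _ _ _ => trivial)
  else
    addMax (liftPoset P a) (belowLevel P a) (belowLevel_isLowerSet_lift P a)

/-- The labelled poset built from a sequence: start with a one-element poset and read the
remaining entries one at a time. The element added when the entry at position `i` is read
carries the label `i`. -/
@[reducible] noncomputable def apLabelled : (n : ℕ) → (Fin n → ℕ) → PartialOrder (Fin n)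
  | 0, _ => inferInstance
  | 1, _ => inferInstance
  | k + 2, a =>
    @PartialOrder.lift (Fin (k + 2)) (Option (Fin (k + 1)))
      (apStep (apLabelled (k + 1) (fun i => a i.castSucc)) (a (Fin.last (k + 1))))
      finSuccEquivLast finSuccEquivLast.injective

/-- The map from ascent sequences of length `n` to unlabelled posets on `n` elements. -/
noncomputable def fAP (n : ℕ) (a : Fin n → ℕ) : UPoset n := unlabel (apLabelled n a)

end AscPoset

/-! A `101`-avoiding ascent sequence `a` is the same thing as a restricted growth function avoiding
`101`: an initial segment with maximum `M` has exactly `M` ascents, one at the first occurrence of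
each positive value. So the next entry is either an old value, hence at most the last entry of the
segment, which is `ℓ*`, or it is `M + 1 = ℓ + 1`. Thus the third rule of the construction never
applies, and the poset of `a` is the order on the positions in which `i` is below `j` if `i` comes
before the first occurrence of the value `a j`.

For the inverse, arrange the elements of a series-parallel interval order `P` by decreasing strict
upset and, within equal strict upsets, by decreasing strict downset, and read off the levels. The
positions of the poset of `a` already are in this arrangement, so `a` is determined by `P`.
`N`-freeness enters through the implication `D(x) ⊂ D(z) → U(x) ⊆ U(z)` for the strict downsets and
upsets of elements with `x ≮ z`. -/

namespace AscPoset

/-! ### Sequences -/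

section Sequences

variable {ι β : Type*}

/-- Restricted growth functions on an ordered set of positions: every entry is preceded by all
smaller values. -/
def IsRGF [LT ι] (a : ι → ℕ) : Prop :=
  ∀ i, ∀ v < a i, ∃ j < i, a j = v

/-- Avoidance of the pattern `101`, for sequences indexed by an ordered set of positions. -/
def Avoids101 [LT ι] [LE β] (a : ι → β) : Prop :=
  ∀ ⦃i j k⦄, i < j → j < k → a i = a k → a k ≤ a j

/-- The positions before the first occurrence of `v` in `a`; these are all positions if `v` does
not occur. -/
def beforeFirst [LT ι] (a : ι → β) (v : β) : Set ι :=
  {i | ∀ k, a k = v → i < k}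

theorem IsRGF.exists_le [Preorder ι] {a : ι → ℕ} (ha : IsRGF a) {i : ι} {v : ℕ} (hv : v ≤ a i) :
    ∃ j ≤ i, a j = v := by
  rcases hv.lt_or_eq with hv | rfl
  · obtain ⟨j, hji, hj⟩ := ha i v hv
    exact ⟨j, hji.le, hj⟩
  · exact ⟨i, le_rfl, rfl⟩

theorem IsRGF.le_add_one_iff [Preorder ι] {a : ι → ℕ} (ha : IsRGF a) {m : ι}
    (hm : ∀ i, a i ≤ a m) {c : ℕ} : c ≤ a m + 1 ↔ ∀ v < c, v ∈ Set.range a := by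
  refine ⟨fun hc v hv => ?_, fun h => not_lt.1 fun hc => ?_⟩
  · obtain ⟨j, -, hj⟩ := ha.exists_le (show v ≤ a m by omega)
    exact ⟨j, hj⟩
  · obtain ⟨j, hj⟩ := h _ hc
    have := hm j
    omega

theorem IsRGF.comp_castLE {m n : ℕ} {a : Fin n → ℕ} (ha : IsRGF a) (h : m ≤ n) :
    IsRGF fun i => a (Fin.castLE h i) := fun i v hv => by
  obtain ⟨j, hji, hj⟩ := ha _ v hv
  exact ⟨⟨j, lt_trans hji i.2⟩, hji, hj⟩

theorem Avoids101.comp_strictMono {κ : Type*} [Preorder κ] [Preorder ι] [LE β] {a : ι → β}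
    (h101 : Avoids101 a) {f : κ → ι} (hf : StrictMono f) : Avoids101 (a ∘ f) :=
  fun _ _ _ hij hjk => h101 (hf hij) (hf hjk)

theorem IsRGF.beforeFirst_subset_iff [LinearOrder ι] [WellFoundedLT ι] {a : ι → ℕ} (ha : IsRGF a)
    {v w : ℕ} (hw : w ∈ Set.range a) : beforeFirst a v ⊆ beforeFirst a w ↔ v ≤ w := by
  constructor
  · contrapose!
    intro hwv hsub
    obtain ⟨m, hm, hmin⟩ := wellFounded_lt.has_min {i | a i = w} hw
    refine lt_irrefl m (hsub (fun k hk => ?_) m hm)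
    obtain ⟨l, hlk, hl⟩ := ha k w (hk ▸ hwv)
    exact (not_lt.1 (hmin l hl)).trans_lt hlk
  · rintro hvw i hi k rfl
    obtain ⟨l, hlk, hl⟩ := ha.exists_le hvw
    exact (hi l hl).trans_le hlk

/-! ### Ascent sequences avoiding `101` -/

theorem IsRGF.lt_iff_forall_ne_of_covBy [LinearOrder ι] {a : ι → ℕ} (ha : IsRGF a)
    (h101 : Avoids101 a) {i j : ι} (hij : i ⋖ j) : a i < a j ↔ ∀ k < j, a k ≠ a j := by
  refine ⟨fun hlt k hkj hk => ?_, fun h => not_le.1 fun hle => ?_⟩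
  · rcases (hij.le_of_lt hkj).lt_or_eq with hki | rfl
    · exact (h101 hki hij.lt hk).not_gt hlt
    · exact hlt.ne hk
  · obtain ⟨k, hki, hk⟩ := ha.exists_le hle
    exact h k (hki.trans_lt hij.lt) hk

theorem asc_eq_of_forall_le {n : ℕ} {b : Fin n → ℕ} (hb : IsRGF b) (h101 : Avoids101 b)
    {m : Fin n} (hm : ∀ i, b i ≤ b m) : asc b = b m := by
  have ascent_iff (j : ℕ) (hj : j + 1 < n) : b ⟨j, Nat.lt_of_succ_lt hj⟩ < b ⟨j + 1, hj⟩ ↔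
      ∀ k < ⟨j + 1, hj⟩, b k ≠ b ⟨j + 1, hj⟩ :=
    hb.lt_iff_forall_ne_of_covBy h101 (Fin.covBy_iff.2 (Order.covBy_add_one j))
  calc asc b = (Set.Ioc 0 (b m)).ncard := Set.ncard_congr (fun j hj => b ⟨j + 1, hj.fst⟩) ?_ ?_ ?_
    _ = b m := by simp [Set.ncard_eq_toFinset_card']
  · rintro j ⟨hj, hlt⟩
    exact ⟨Nat.zero_lt_of_lt hlt, hm _⟩
  · rintro i j ⟨hi, hbi⟩ ⟨hj, hbj⟩ heq
    rw [ascent_iff] at hbi hbj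
    have hij := not_lt.1 fun h => hbi ⟨j + 1, hj⟩ h heq.symm
    have hji := not_lt.1 fun h => hbj ⟨i + 1, hi⟩ h heq
    simpa using le_antisymm hij hji
  · rintro v ⟨hv0, hvm⟩
    obtain ⟨i₀, -, hi₀⟩ := hb.exists_le hvm
    obtain ⟨⟨i, hin⟩, rfl, hmin⟩ := wellFounded_lt.has_min {i | b i = v} ⟨i₀, hi₀⟩
    cases i with
    | zero =>
      obtain ⟨j, hj, -⟩ := hb _ 0 hv0
      exact absurd hj (Nat.not_lt_zero _)
    | succ j => exact ⟨j, ⟨hin, (ascent_iff j hin).2 fun k hk hbk => hmin k hbk hk⟩, rfl⟩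

theorem le_asc_add_one_iff {n : ℕ} [NeZero n] {b : Fin n → ℕ} (hb : IsRGF b) (h101 : Avoids101 b)
    {c : ℕ} : c ≤ asc b + 1 ↔ ∀ v < c, v ∈ Set.range b := by
  obtain ⟨m, hm⟩ := Finite.exists_max b
  rw [asc_eq_of_forall_le hb h101 hm, hb.le_add_one_iff hm]

theorem not_containsPattern_101_iff {n : ℕ} {a : Fin n → ℕ} :
    ¬ ContainsPattern a ![1, 0, 1] ↔ Avoids101 a := by
  refine ⟨fun h i j k hij hjk hik => ?_, ?_⟩
  · by_contra! hlt
    refine h ⟨![i, j, k], ?_, fun r s => ?_⟩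
    · simp [Fin.strictMono_iff_lt_succ, Fin.forall_fin_two, hij, hjk]
    · fin_cases r <;> fin_cases s <;> simp [hik, hlt, hlt.le]
  · rintro h101 ⟨f, hf, hp⟩
    have h02 : a (f 0) = a (f 2) :=
      le_antisymm (not_lt.1 (by simp [hp])) (not_lt.1 (by simp [hp]))
    have h12 : a (f 1) < a (f 2) := by simp [hp]
    exact (h101 (hf (by decide)) (hf (by decide)) h02).not_gt h12

theorem mem_CAsc_iff {n : ℕ} {a : Fin n → ℕ} : a ∈ CAsc n ↔ IsRGF a ∧ Avoids101 a := by
  rw [CAsc, Set.mem_ofPred_eq, not_containsPattern_101_iff]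
  refine and_congr_left fun h101 => ?_
  have h101_before (i : Fin n) : Avoids101 (before a i) :=
    h101.comp_strictMono (Fin.strictMono_castLE i.2.le)
  constructor
  · rintro ⟨h0, h1⟩ i
    induction i using WellFoundedLT.induction with
    | _ i ih =>
      intro v hv
      have hi : 0 < i.1 := Nat.pos_of_ne_zero fun hi => by simp [h0 i hi] at hv
      have : NeZero i.1 := ⟨hi.ne'⟩
      have hrgf : IsRGF (before a i) := fun j w hw => by
        obtain ⟨k, hkj, hk⟩ := ih (Fin.castLE i.2.le j) j.2 w hw
        exact ⟨⟨k, lt_trans hkj j.2⟩, hkj, hk⟩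
      obtain ⟨j, hj⟩ := (le_asc_add_one_iff hrgf (h101_before i)).1 (h1 i hi) v hv
      exact ⟨Fin.castLE i.2.le j, j.2, hj⟩
  · refine fun ha => ⟨fun i hi => ?_, fun i hi => ?_⟩
    · by_contra hne
      obtain ⟨j, hj, -⟩ := ha i 0 (Nat.pos_of_ne_zero hne)
      exact absurd hj (by simp [Fin.lt_def, hi])
    · have : NeZero i.1 := ⟨hi.ne'⟩
      refine (le_asc_add_one_iff (ha.comp_castLE i.2.le) (h101_before i)).2 fun v hv => ?_
      obtain ⟨j, hji, hj⟩ := ha i v hv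
      exact ⟨⟨j, hji⟩, hj⟩

end Sequences

/-! ### Levels of `(2+2)`-free posets -/

section Levels

variable {α : Type} {P : PartialOrder α}

theorem twoPlusTwoFree_iff :
    TwoPlusTwoFree P ↔ ∀ x y : α, Set.Iio x ⊆ Set.Iio y ∨ Set.Iio y ⊆ Set.Iio x := by
  refine ⟨fun h x y => ?_, ?_⟩
  · by_contra! hxy
    obtain ⟨⟨u, hux, huy⟩, v, hvy, hvx⟩ := hxy.imp Set.not_subset.1 Set.not_subset.1
    simp only [Set.mem_Iio] at hux huy hvy hvx
    refine h ⟨u, x, v, y, hux, hvy, ?_⟩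
    refine ⟨⟨?_, ?_⟩, ⟨?_, ?_⟩, ⟨?_, ?_⟩, ⟨?_, ?_⟩⟩ <;> intro hle <;> order
  · rintro h ⟨e, f, g, h', hef, hgh, -, heh, hfg, -⟩
    rcases h f h' with hsub | hsub
    · exact heh.1 (hsub hef).le
    · exact hfg.2 (hsub hgh).le

theorem TwoPlusTwoFree.Iio_subset_Iio_of_not_lt_of_lt (h : TwoPlusTwoFree P) {x z w : α}
    (hxz : ¬ x < z) (hxw : x < w) : Set.Iio z ⊆ Set.Iio w :=
  (twoPlusTwoFree_iff.1 h z w).resolve_right fun hwz => hxz (hwz hxw)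

theorem TwoPlusTwoFree.Iio_eq_of_ncard_eq [Finite α] (h : TwoPlusTwoFree P) {x y : α}
    (hxy : (Set.Iio x).ncard = (Set.Iio y).ncard) : Set.Iio x = Set.Iio y := by
  rcases twoPlusTwoFree_iff.1 h x y with hsub | hsub
  · exact Set.eq_of_subset_of_ncard_le hsub hxy.ge
  · exact (Set.eq_of_subset_of_ncard_le hsub hxy.le).symm

theorem level_congr {x y : α} (h : Set.Iio x = Set.Iio y) : level P x = level P y := by
  rw [level, level, h]

theorem level_lt_level_of_Iio_ssubset [Finite α] {x y : α} (h : Set.Iio x ⊂ Set.Iio y) :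
    level P x < level P y := by
  refine Set.ncard_lt_ncard ⟨fun D hD => ⟨hD.1, hD.2.trans h⟩, fun hsub => ?_⟩
  exact (hsub ⟨⟨x, rfl⟩, h⟩).2.ne rfl

theorem TwoPlusTwoFree.level_le_level_iff [Finite α] (h : TwoPlusTwoFree P) {x y : α} :
    level P x ≤ level P y ↔ Set.Iio x ⊆ Set.Iio y := by
  refine ⟨fun hle => ?_, fun hsub => ?_⟩
  · by_contra hxy
    exact (level_lt_level_of_Iio_ssubset
      ⟨(twoPlusTwoFree_iff.1 h x y).resolve_left hxy, hxy⟩).not_ge hle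
  · rcases hsub.eq_or_ssubset with heq | hss
    · exact (level_congr heq).le
    · exact (level_lt_level_of_Iio_ssubset hss).le

theorem TwoPlusTwoFree.level_eq_level_iff [Finite α] (h : TwoPlusTwoFree P) {x y : α} :
    level P x = level P y ↔ Set.Iio x = Set.Iio y := by
  rw [le_antisymm_iff, h.level_le_level_iff, h.level_le_level_iff, Set.Subset.antisymm_iff]

theorem TwoPlusTwoFree.level_lt_level_iff [Finite α] (h : TwoPlusTwoFree P) {x y : α} :
    level P x < level P y ↔ Set.Iio x ⊂ Set.Iio y := by
  rw [lt_iff_le_not_ge, h.level_le_level_iff, h.level_le_level_iff, ssubset_iff_subset_not_subset]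

theorem TwoPlusTwoFree.exists_level_eq [Finite α] (h : TwoPlusTwoFree P) {x : α} {v : ℕ}
    (hv : v < level P x) : ∃ y : α, level P y = v := by
  -- Pigeonhole: the `level P x` strict downsets below `Iio x` have distinct levels, all smaller
  -- than `level P x`.
  let S : Set (Set α) := {D | D ∈ Set.range (fun y : α => Set.Iio y) ∧ D ⊂ Set.Iio x}
  let levelOf (D : Set α) : ℕ := {E | E ∈ Set.range (fun y : α => Set.Iio y) ∧ E ⊂ D}.ncard
  have hmaps : levelOf '' S ⊆ Set.Iio (level P x) := by
    rintro _ ⟨_, ⟨⟨y, rfl⟩, hy⟩, rfl⟩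
    exact level_lt_level_of_Iio_ssubset hy
  have hinj : Set.InjOn levelOf S := by
    rintro _ ⟨⟨y, rfl⟩, -⟩ _ ⟨⟨z, rfl⟩, -⟩ heq
    exact h.level_eq_level_iff.1 heq
  have himage : levelOf '' S = Set.Iio (level P x) := by
    refine Set.eq_of_subset_of_ncard_le hmaps ?_
    rw [hinj.ncard_image, Set.ncard_eq_toFinset_card' (Set.Iio _)]
    simp [S, level]
  obtain ⟨_, ⟨⟨y, rfl⟩, -⟩, hy⟩ := himage.ge hv
  exact ⟨y, hy⟩

theorem TwoPlusTwoFree.belowLevel_level [Finite α] (h : TwoPlusTwoFree P) (x : α) :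
    belowLevel P (level P x) = Set.Iio x := by
  ext y
  refine ⟨?_, fun hy => ⟨x, rfl, hy⟩⟩
  rintro ⟨z, hz, hyz⟩
  exact (h.level_eq_level_iff.1 hz).le hyz

theorem ell_eq_level_of_forall_Iio_subset [Finite α] {t : α}
    (ht : ∀ x : α, Set.Iio x ⊆ Set.Iio t) : ell P = level P t := by
  let R : Set (Set α) := Set.range fun y : α => Set.Iio y
  have hnonempty : {D | D ∈ R ∧ D.Nonempty} = R \ {∅} := by
    ext D
    simp [Set.nonempty_iff_ne_empty]
  have hssubset : {D | D ∈ R ∧ D ⊂ Set.Iio t} = R \ {Set.Iio t} := by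
    ext D
    refine and_congr_right ?_
    rintro ⟨y, rfl⟩
    exact ⟨fun hy => hy.ne, fun hy => (ht y).ssubset_of_ne hy⟩
  obtain ⟨m, -, hm⟩ := wellFounded_lt.has_min (Set.univ : Set α) ⟨t, trivial⟩
  have hmR : ∅ ∈ R := ⟨m, Set.eq_empty_of_forall_notMem fun y => hm y trivial⟩
  have htR : Set.Iio t ∈ R := ⟨t, rfl⟩
  calc ell P = (R \ {∅}).ncard := congrArg Set.ncard hnonempty
    _ = R.ncard - 1 := Set.ncard_sdiff_singleton_of_mem hmR
    _ = (R \ {Set.Iio t}).ncard := (Set.ncard_sdiff_singleton_of_mem htR).symm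
    _ = level P t := (congrArg Set.ncard hssubset).symm

theorem ellStar_eq_level {x : α} (hx : IsMax x)
    (hmin : ∀ y : α, IsMax y → level P x ≤ level P y) : ellStar P = level P x := by
  refine IsLeast.csInf_eq ⟨⟨x, hx, rfl⟩, ?_⟩
  rintro _ ⟨y, hy, rfl⟩
  exact hmin y hy

theorem eq_of_le_iff_le_of_forall_lt_mem_range {γ : Type*} {f g : γ → ℕ}
    (hfg : ∀ x y, f x ≤ f y ↔ g x ≤ g y) (hf : ∀ x, ∀ v < f x, v ∈ Set.range f)
    (hg : ∀ x, ∀ v < g x, v ∈ Set.range g) : f = g := by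
  have hlt (x y : γ) : f x < f y ↔ g x < g y := by rw [← not_le, ← not_le, hfg]
  funext x
  induction hn : f x using Nat.strong_induction_on generalizing x with
  | _ n ih =>
    subst hn
    rcases lt_trichotomy (f x) (g x) with hx | hx | hx
    · obtain ⟨y, hy⟩ := hg x _ hx
      have hyx : f y < f x := (hlt y x).2 (hy ▸ hx)
      exact absurd ((ih _ hyx y rfl).trans hy) hyx.ne
    · exact hx
    · obtain ⟨y, hy⟩ := hf x _ hx
      have hyx : f y < f x := hy ▸ hx
      have hgy : g y = g x := (ih _ hyx y rfl).symm.trans hy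
      exact absurd hgy ((hlt y x).1 hyx).ne

end Levels

/-! ### The canonical arrangement of a poset -/

section SortKey

open OrderDual

variable {α : Type} {P : PartialOrder α}

/-- The key by which the elements of `P` are arranged: large strict upsets come first, and among
elements with strict upsets of the same size those with large strict downsets come first. In a
`(2+2)`-free poset both families of sets are chains, so that comparing sizes compares the sets. -/
noncomputable def sortKey (P : PartialOrder α) (x : α) : ℕᵒᵈ ×ₗ ℕᵒᵈ :=
  toLex (toDual (Set.Ioi x).ncard, toDual (Set.Iio x).ncard)

theorem sortKey_le_sortKey [Finite α] {x y : α} (hIoi : Set.Ioi y ⊆ Set.Ioi x)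
    (hIio : Set.Iio y ⊆ Set.Iio x) : sortKey P x ≤ sortKey P y :=
  Prod.Lex.toLex_mono ⟨Set.ncard_le_ncard hIoi, Set.ncard_le_ncard hIio⟩

theorem sortKey_lt_sortKey [Finite α] {x y : α} (hIoi : Set.Ioi y ⊆ Set.Ioi x)
    (hIio : Set.Iio y ⊂ Set.Iio x) : sortKey P x < sortKey P y :=
  Prod.Lex.toLex_strictMono
    (Prod.mk_lt_mk_of_le_of_lt (Set.ncard_le_ncard hIoi) (Set.ncard_lt_ncard hIio))

theorem sortKey_strictMono [Finite α] : StrictMono (sortKey P) := fun _ _ hxy =>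
  Prod.Lex.toLex_lt_toLex.2 (Or.inl (Set.ncard_lt_ncard (Set.Ioi_ssubset_Ioi hxy)))

theorem TwoPlusTwoFree.Iio_eq_of_sortKey_eq [Finite α] (h : TwoPlusTwoFree P) {x y : α}
    (hxy : sortKey P x = sortKey P y) : Set.Iio x = Set.Iio y :=
  h.Iio_eq_of_ncard_eq (congrArg (fun k => ofDual (ofLex k).2) hxy)

theorem NFree.Ioi_subset_Ioi_of_Iio_ssubset (hN : NFree P) (h22 : TwoPlusTwoFree P) {x z : α}
    (hxz : ¬ x < z) (hlt : Set.Iio x ⊂ Set.Iio z) : Set.Ioi x ⊆ Set.Ioi z := by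
  intro w hxw
  by_contra hzw
  obtain ⟨f, hfz, hfx⟩ := Set.exists_of_ssubset hlt
  have hfw : f < w := h22.Iio_subset_Iio_of_not_lt_of_lt hxz hxw hfz
  have hne : x ≠ z := fun h => hlt.ne (congrArg Set.Iio h)
  simp only [Set.mem_Iio, Set.mem_Ioi] at hfz hfx hxw hzw
  refine hN ⟨x, f, z, w, hxw, hfw, hfz, ⟨?_, ?_⟩, ⟨?_, ?_⟩, ⟨?_, ?_⟩⟩ <;> intro hle <;> order [hne]

theorem exists_Iio_eq_sortKey_le [Finite α] (h22 : TwoPlusTwoFree P) (hN : NFree P) {x z : α}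
    (hxz : ¬ x < z) : ∃ y : α, Set.Iio y = Set.Iio z ∧ sortKey P y ≤ sortKey P x := by
  obtain ⟨u, hux, hu⟩ := exists_minimal_le_of_wellFoundedLT (fun u => ¬ u < z) x hxz
  have hkey : sortKey P u ≤ sortKey P x := sortKey_strictMono.monotone hux
  have hsub : Set.Iio u ⊆ Set.Iio z := fun w hw => by
    by_contra hwz
    exact (hu.2 hwz (le_of_lt hw)).not_gt hw
  rcases hsub.eq_or_ssubset with heq | hss
  · exact ⟨u, heq, hkey⟩
  · exact ⟨z, rfl, (sortKey_le_sortKey (hN.Ioi_subset_Ioi_of_Iio_ssubset h22 hu.1 hss) hsub).trans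
      hkey⟩

end SortKey

/-! ### Posets realized by sequences -/

section Realizes

variable {ι β : Type*} {α : Type}

/-- The bijection `e` from positions to elements identifies `P` with the poset of the sequence `a`,
in which position `i` is below position `j` if it comes before the first occurrence of `a j`. -/
def Realizes [LT ι] (P : PartialOrder α) (a : ι → β) (e : ι ≃ α) : Prop :=
  ∀ i j, e i < e j ↔ i ∈ beforeFirst a (a j)

theorem Realizes.trans_orderIso {α' : Type} [LT ι] {P : PartialOrder α} {Q : PartialOrder α'}
    {a : ι → β} {e : ι ≃ α} (he : Realizes P a e) (g : α ≃o α') :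
    Realizes Q a (e.trans g.toEquiv) :=
  fun i j => g.lt_iff_lt.trans (he i j)

theorem Realizes.isom {α' : Type} [LT ι] {P : PartialOrder α} {Q : PartialOrder α'} {a : ι → β}
    {e : ι ≃ α} {f : ι ≃ α'} (he : Realizes P a e) (hf : Realizes Q a f) : Isom P Q :=
  ⟨OrderIso.ofRelIsoLT ⟨e.symm.trans f, fun {x y} => by
    rw [Equiv.trans_apply, Equiv.trans_apply, hf, ← he, e.apply_symm_apply, e.apply_symm_apply]⟩⟩

variable {P : PartialOrder α}

theorem Realizes.Iio_eq [LT ι] {a : ι → β} {e : ι ≃ α} (he : Realizes P a e) (j : ι) :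
    Set.Iio (e j) = e '' beforeFirst a (a j) := by
  ext x
  obtain ⟨i, rfl⟩ := e.surjective x
  rw [Set.mem_Iio, he, e.injective.mem_set_image]

theorem Realizes.lt_of_lt [LT ι] {a : ι → β} {e : ι ≃ α} (he : Realizes P a e) {i j : ι}
    (h : e i < e j) : i < j :=
  (he i j).1 h j rfl

theorem Realizes.exists_le_of_not_lt [LinearOrder ι] {a : ι → β} {e : ι ≃ α}
    (he : Realizes P a e) {i j : ι} (h : ¬ e i < e j) : ∃ k ≤ i, a k = a j := by
  rw [he, beforeFirst, Set.mem_ofPred_eq] at h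
  push Not at h
  obtain ⟨k, hk, hki⟩ := h
  exact ⟨k, hki, hk⟩

theorem Realizes.le_of_not_lt [LinearOrder ι] [Preorder β] {a : ι → β} {e : ι ≃ α}
    (he : Realizes P a e) (h101 : Avoids101 a) {i j : ι} (hij : i < j) (h : ¬ e i < e j) :
    a j ≤ a i := by
  obtain ⟨k, hki, hk⟩ := he.exists_le_of_not_lt h
  rcases hki.lt_or_eq with hki | rfl
  · exact h101 hki hij hk
  · exact hk.ge

theorem Realizes.twoPlusTwoFree [LinearOrder ι] {a : ι → β} {e : ι ≃ α} (he : Realizes P a e) :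
    TwoPlusTwoFree P := by
  have isLowerSet (v : β) : IsLowerSet (beforeFirst a v) :=
    fun i j hji hi k hk => hji.trans_lt (hi k hk)
  refine twoPlusTwoFree_iff.2 fun x y => ?_
  obtain ⟨i, rfl⟩ := e.surjective x
  obtain ⟨j, rfl⟩ := e.surjective y
  rw [he.Iio_eq, he.Iio_eq]
  exact ((isLowerSet _).total (isLowerSet _)).imp Set.image_mono Set.image_mono

variable [LinearOrder ι] {a : ι → ℕ} {e : ι ≃ α}

theorem Realizes.Iio_subset_Iio_iff [WellFoundedLT ι] (he : Realizes P a e) (ha : IsRGF a)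
    {i j : ι} : Set.Iio (e i) ⊆ Set.Iio (e j) ↔ a i ≤ a j := by
  rw [he.Iio_eq, he.Iio_eq, Set.image_subset_image_iff e.injective,
    ha.beforeFirst_subset_iff ⟨j, rfl⟩]

theorem Realizes.nFree [WellFoundedLT ι] (he : Realizes P a e) (ha : IsRGF a)
    (h101 : Avoids101 a) : NFree P := by
  rintro ⟨x, y, z, w, hxw, hyw, hyz, hxy, hxz, hzw⟩
  obtain ⟨i, rfl⟩ := e.surjective x
  obtain ⟨j, rfl⟩ := e.surjective z
  have hlt : a i < a j := by
    by_contra! hle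
    exact hxy.2 ((he.Iio_subset_Iio_iff ha).2 hle hyz).le
  have hij : i < j := by
    by_contra! hji
    obtain ⟨l, rfl⟩ := e.surjective w
    refine hzw.1 (le_of_lt ((he j l).2 fun k hk => ?_))
    exact hji.trans_lt ((he i l).1 hxw k hk)
  exact (he.le_of_not_lt h101 hij fun h => hxz.1 h.le).not_gt hlt

variable [Finite α]

theorem Realizes.level_eq (he : Realizes P a e) (ha : IsRGF a) (j : ι) :
    level P (e j) = a j := by
  have : Finite ι := .of_equiv α e.symm
  have h22 := he.twoPlusTwoFree
  suffices level P ∘ e = a from congrFun this j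
  refine eq_of_le_iff_le_of_forall_lt_mem_range (fun i j => ?_) ?_ ?_
  · rw [Function.comp_apply, Function.comp_apply, h22.level_le_level_iff,
      he.Iio_subset_Iio_iff ha]
  · intro i v hv
    obtain ⟨y, hy⟩ := h22.exists_level_eq hv
    exact ⟨e.symm y, by simpa using hy⟩
  · intro i v hv
    obtain ⟨k, -, hk⟩ := ha i v hv
    exact ⟨k, hk⟩

theorem Realizes.ell_eq (he : Realizes P a e) (ha : IsRGF a) {m : ι}
    (hm : ∀ i, a i ≤ a m) : ell P = a m := by
  have : Finite ι := .of_equiv α e.symm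
  rw [← he.level_eq ha]
  refine ell_eq_level_of_forall_Iio_subset fun x => ?_
  obtain ⟨i, rfl⟩ := e.surjective x
  exact (he.Iio_subset_Iio_iff ha).2 (hm i)

theorem Realizes.ellStar_eq (he : Realizes P a e) (ha : IsRGF a)
    (h101 : Avoids101 a) {t : ι} (ht : IsTop t) : ellStar P = a t := by
  rw [← he.level_eq ha]
  refine ellStar_eq_level (isMax_iff_forall_not_lt.2 fun x hx => ?_) fun y hy => ?_
  · obtain ⟨i, rfl⟩ := e.surjective x
    exact (ht i).not_gt (he.lt_of_lt hx)
  · obtain ⟨i, rfl⟩ := e.surjective y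
    rw [he.level_eq ha, he.level_eq ha]
    rcases (ht i).lt_or_eq with hit | rfl
    · exact he.le_of_not_lt h101 hit hy.not_lt
    · exact le_rfl

theorem Realizes.belowLevel_eq (he : Realizes P a e) (ha : IsRGF a) (j : ι) :
    belowLevel P (a j) = e '' beforeFirst a (a j) := by
  rw [← he.Iio_eq, ← he.twoPlusTwoFree.belowLevel_level, he.level_eq ha]

theorem Realizes.monotone_sortKey (he : Realizes P a e) (ha : IsRGF a)
    (h101 : Avoids101 a) : Monotone (sortKey P ∘ e) := by
  have : Finite ι := .of_equiv α e.symm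
  intro i j hij
  rcases hij.eq_or_lt with rfl | hij
  · exact le_rfl
  by_cases h : e i < e j
  · exact (sortKey_strictMono h).le
  refine sortKey_le_sortKey (fun x hx => ?_)
    ((he.Iio_subset_Iio_iff ha).2 (he.le_of_not_lt h101 hij h))
  obtain ⟨l, rfl⟩ := e.surjective x
  exact (he i l).2 fun k hk => hij.trans ((he j l).1 hx k hk)

theorem realizes_level_of_monotone_sortKey (h22 : TwoPlusTwoFree P) (hN : NFree P)
    (hmono : Monotone (sortKey P ∘ e)) : Realizes P (level P ∘ e) e := by
  intro i j
  refine ⟨fun hij k hk => hmono.reflect_lt (sortKey_strictMono ?_), fun hi => ?_⟩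
  · exact (h22.level_eq_level_iff.1 hk).ge hij
  by_contra hij
  obtain ⟨y, hy, hkey⟩ := exists_Iio_eq_sortKey_le h22 hN hij
  obtain ⟨k, rfl⟩ := e.surjective y
  have hik : i < k := hi k (level_congr hy)
  have hkey' := h22.Iio_eq_of_sortKey_eq (le_antisymm (hmono hik.le) hkey)
  exact lt_irrefl i (hi i (level_congr (hkey'.trans hy)))

theorem isRGF_level_of_monotone_sortKey (h22 : TwoPlusTwoFree P) (hN : NFree P)
    (hmono : Monotone (sortKey P ∘ e)) : IsRGF (level P ∘ e) := by
  intro i v hv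
  obtain ⟨y, rfl⟩ := h22.exists_level_eq hv
  obtain ⟨j, rfl⟩ := e.surjective y
  have hij : ¬ e i < e j := fun h => (level_lt P h).not_gt hv
  obtain ⟨k, hki, hk⟩ := (realizes_level_of_monotone_sortKey h22 hN hmono).exists_le_of_not_lt hij
  refine ⟨k, hki.lt_of_ne ?_, hk⟩
  rintro rfl
  exact hv.ne' hk

theorem avoids101_level_of_monotone_sortKey (h22 : TwoPlusTwoFree P) (hN : NFree P)
    (hmono : Monotone (sortKey P ∘ e)) : Avoids101 (level P ∘ e) := by
  intro i j k hij hjk hik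
  by_contra! hlt
  have hjk' : ¬ e j < e k := fun h => by
    have hji : e j < e i := (h22.level_eq_level_iff.1 hik).ge h
    exact (hmono hij.le).not_gt (sortKey_strictMono hji)
  have hss := h22.level_lt_level_iff.1 hlt
  exact (hmono hjk.le).not_gt
    (sortKey_lt_sortKey (hN.Ioi_subset_Ioi_of_Iio_ssubset h22 hjk' hss) hss)

end Realizes

/-! ### The bijection -/

section Bijection

variable {α : Type} {n : ℕ} {a : Fin (n + 1) → ℕ} {e : Fin n ≃ α}

theorem castSucc_mem_beforeFirst_iff {β : Type*} (a : Fin (n + 1) → β) (i : Fin n) (v : β) :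
    i.castSucc ∈ beforeFirst a v ↔ i ∈ beforeFirst (Fin.init a) v := by
  refine ⟨fun h k hk => h k.castSucc hk, fun h k hk => ?_⟩
  induction k using Fin.lastCases with
  | last => exact Fin.castSucc_lt_last i
  | cast k => exact h k hk

theorem Realizes.addMax {P : PartialOrder α} (he : Realizes P (Fin.init a) e) {S : Set α}
    (hS : IsLowerSet S) (h : S = e '' beforeFirst (Fin.init a) (a (Fin.last n))) :
    Realizes (addMax P S hS) a (finSuccEquivLast.trans e.optionCongr) := by
  intro i j
  induction i using Fin.lastCases with
  | last =>
    simp only [Equiv.trans_apply, finSuccEquivLast_last]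
    exact iff_of_false id fun hlast => (hlast j rfl).not_ge (Fin.le_last j)
  | cast i =>
    rw [castSucc_mem_beforeFirst_iff]
    induction j using Fin.lastCases with
    | last =>
      simp only [Equiv.trans_apply, finSuccEquivLast_last, finSuccEquivLast_castSucc]
      change e i ∈ S ↔ _
      rw [h, e.injective.mem_set_image]
    | cast j =>
      simp only [Equiv.trans_apply, finSuccEquivLast_castSucc]
      exact he i j

theorem Realizes.apStep [Finite α] {P : PartialOrder α} [NeZero n]
    (he : Realizes P (Fin.init a) e) (ha : IsRGF a) (h101 : Avoids101 a) :
    Realizes (apStep P (a (Fin.last n))) a (finSuccEquivLast.trans e.optionCongr) := by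
  have ha' : IsRGF (Fin.init a) := ha.comp_castLE n.le_succ
  have h101' : Avoids101 (Fin.init a) := h101.comp_strictMono Fin.strictMono_castSucc
  by_cases hmem : a (Fin.last n) ∈ Set.range (Fin.init a)
  · obtain ⟨j, hj⟩ := hmem
    have hle : a (Fin.last n) ≤ ellStar P := by
      rw [he.ellStar_eq ha' h101' (t := ⊤) fun i => le_top]
      rcases (le_top : j ≤ ⊤).lt_or_eq with hlt | rfl
      · exact h101 (Fin.castSucc_lt_castSucc_iff.2 hlt) (Fin.castSucc_lt_last _) hj
      · exact hj.ge
    rw [AscPoset.apStep, if_pos hle]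
    exact he.addMax _ (hj ▸ he.belowLevel_eq ha' j)
  · obtain ⟨m, hm⟩ := Finite.exists_max (Fin.init a)
    have hle : a (Fin.last n) ≤ Fin.init a m + 1 := (ha'.le_add_one_iff hm).2 fun v hv => by
      obtain ⟨j, hj, rfl⟩ := ha _ v hv
      exact ⟨j.castPred hj.ne, rfl⟩
    have hlt : Fin.init a m < a (Fin.last n) := by
      by_contra! hle
      obtain ⟨j, -, hj⟩ := ha'.exists_le hle
      exact hmem ⟨j, hj⟩
    have hell : a (Fin.last n) = ell P + 1 := by
      rw [he.ell_eq ha' hm]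
      omega
    have hellStar : ¬ a (Fin.last n) ≤ ellStar P := by
      rw [he.ellStar_eq ha' h101' (t := ⊤) fun i => le_top]
      exact ((hm ⊤).trans_lt hlt).not_ge
    have hbefore : beforeFirst (Fin.init a) (a (Fin.last n)) = Set.univ :=
      Set.eq_univ_of_forall fun i k hk => absurd ⟨k, hk⟩ hmem
    rw [AscPoset.apStep, if_neg hellStar, if_pos hell]
    exact he.addMax _ (by rw [hbefore, Set.image_univ, e.range_eq_univ])

theorem realizes_apLabelled : ∀ {n : ℕ} {a : Fin n → ℕ}, IsRGF a → Avoids101 a →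
    Realizes (apLabelled n a) a (Equiv.refl _)
  | 0, _, _, _ => fun i => i.elim0
  | 1, _, _, _ => fun i j => iff_of_false (fun h => h.ne (Subsingleton.elim _ _)) fun h =>
      (h j rfl).ne (Subsingleton.elim _ _)
  | n + 2, _, ha, h101 => by
    have ih := realizes_apLabelled (ha.comp_castLE (n + 1).le_succ)
      (h101.comp_strictMono Fin.strictMono_castSucc)
    have hstep := ih.apStep ha h101
    rwa [Equiv.optionCongr_refl, Equiv.trans_refl] at hstep

theorem Realizes.unique {P : PartialOrder α} {a b : Fin n → ℕ} {e f : Fin n ≃ α}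
    (he : Realizes P a e) (hf : Realizes P b f) (ha : IsRGF a) (ha101 : Avoids101 a)
    (hb : IsRGF b) (hb101 : Avoids101 b) : a = b := by
  have : Finite α := .of_equiv _ e
  have hcomp : (sortKey P ∘ e) ∘ f.trans e.symm = sortKey P ∘ f := by
    funext i
    simp
  have hkey : sortKey P ∘ e = sortKey P ∘ f := hcomp ▸ Tuple.unique_monotone
    (σ := Equiv.refl (Fin n)) (he.monotone_sortKey ha ha101)
    (hcomp ▸ hf.monotone_sortKey hb hb101)
  funext i
  rw [← he.level_eq ha, ← hf.level_eq hb]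
  exact level_congr (he.twoPlusTwoFree.Iio_eq_of_sortKey_eq (congrFun hkey i))

theorem mapsTo_fAP (n : ℕ) : Set.MapsTo (fAP n) (CAsc n) (CPosets n) := by
  intro a ha
  obtain ⟨ha, h101⟩ := mem_CAsc_iff.1 ha
  have hreal := realizes_apLabelled ha h101
  exact ⟨apLabelled n a, hreal.twoPlusTwoFree, hreal.nFree ha h101, rfl⟩

theorem injOn_fAP (n : ℕ) : Set.InjOn (fAP n) (CAsc n) := by
  intro a ha b hb hab
  obtain ⟨ha, ha101⟩ := mem_CAsc_iff.1 ha
  obtain ⟨hb, hb101⟩ := mem_CAsc_iff.1 hb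
  obtain ⟨g⟩ := Quotient.exact hab
  exact ((realizes_apLabelled ha ha101).trans_orderIso g).unique (realizes_apLabelled hb hb101)
    ha ha101 hb hb101

theorem surjOn_fAP (n : ℕ) : Set.SurjOn (fAP n) (CAsc n) (CPosets n) := by
  rintro _ ⟨P, h22, hN, rfl⟩
  have hmono := Tuple.monotone_sort (sortKey P)
  have hrgf := isRGF_level_of_monotone_sortKey h22 hN hmono
  have h101 := avoids101_level_of_monotone_sortKey h22 hN hmono
  have hreal := realizes_level_of_monotone_sortKey h22 hN hmono
  exact ⟨_, mem_CAsc_iff.2 ⟨hrgf, h101⟩,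
    Quotient.sound ((realizes_apLabelled hrgf h101).isom hreal)⟩

end Bijection

end AscPoset

theorem mainTheorem5 (n : ℕ) (hn : 1 ≤ n) :
    Set.BijOn (AscPoset.fAP n) (AscPoset.CAsc n) (AscPoset.CPosets n) :=
  ⟨AscPoset.mapsTo_fAP n, AscPoset.injOn_fAP n, AscPoset.surjOn_fAP n⟩
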